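/- Let $d \ge 0$ be an integer, let $k=\lfloor d/2\rfloor$, and let $P$ be a polynomial with complex coefficients, of degree exactly $d$, such that $P(e^{i\theta})=\overline{P(e^{-i\theta})}$ for all real $\theta$. Suppose that all $d$ zeros of $P$, counted with multiplicity, lie on the unit circle and are given by $e^{it_1},e^{-it_1},\dots,e^{it_k},e^{-it_k}$, together with one further zero $-1$ if $d$ is odd, where $0<t_1\le t_2\le\dots\le t_k\le\pi$. Put $t_0=0$ and $t_{k+1}=\pi$. Then for every $0<q<\infty$ the integrands below are integrable and \[ |P(1)|^q=\sum_{n=0}^{k}\int_{t_n}^{t_{n+1}}|P(e^{i\theta})|^q\,\frac{\sin\left(\left(\frac{d}{2}q+\frac12\right)\theta-\pi q n\right)}{\sin\frac{\theta}{2}}\,\frac{d\theta}{\pi}. \] -/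

import Mathlib

/-! On the unit circle `|P|^q` is the modulus of a function `F` holomorphic in the disc: factor `P`
and take principal `q`-th powers of `1 - z e^{is}`, whose real part is positive inside. On the upper
half circle the phase of `F` is `dqθ/2 - πqn` on the `n`-th arc, since each zero passed turns it by
`-πq` (`diskPower_exp`). As `z = 1` is not a zero, `2z (F(z) - F(1)) / (z - 1)` extends continuously
to the closed disc. It vanishes at `0`, so its mean over the circle is zero, and conjugation
symmetry gives mean zero for its real part on `[0, π]`. That real part is `Im(F e^{iθ/2}) / sin(θ/2)
- F(1)`, where `F(1) = |P(1)|^q`, and the phase turns the imaginary part into the sines of the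
formula. -/

/-! ### The mean value identity and the conjugate kernel. -/

/-- If `F` is continuous on the closed unit disc, holomorphic inside it, differentiable at `1` and
commutes with complex conjugation on the unit circle, then the real part of
`2 * z * dslope F 1 z` has mean zero on the upper half of the unit circle. -/
theorem integral_re_two_mul_dslope_eq_zero {F : ℂ → ℂ}
    (hc : ContinuousOn F (Metric.closedBall 0 1)) (hd : DifferentiableOn ℂ F (Metric.ball 0 1))
    (h1 : DifferentiableAt ℂ F 1)
    (hconj : ∀ z : ℂ, ‖z‖ = 1 → F ((starRingEnd ℂ) z) = (starRingEnd ℂ) (F z)) :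
    Continuous (fun θ : ℝ => (2 * Complex.exp (θ * Complex.I) *
      dslope F 1 (Complex.exp (θ * Complex.I))).re) ∧
    ∫ θ in (0 : ℝ)..Real.pi, (2 * Complex.exp (θ * Complex.I) *
      dslope F 1 (Complex.exp (θ * Complex.I))).re = 0 := by
  set Q : ℂ → ℂ := fun z => 2 * z * dslope F 1 z with hQ
  have hslope : ContinuousOn (dslope F 1) (Metric.closedBall 0 1) := by
    intro z hz
    rcases eq_or_ne z 1 with rfl | hne
    · exact (continuousAt_dslope_same.2 h1).continuousWithinAt
    · exact (continuousWithinAt_dslope_of_ne hne).2 (hc z hz)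
  have hQc : ContinuousOn Q (Metric.closedBall 0 1) := by
    apply ContinuousOn.mul _ hslope
    fun_prop
  have hQd : ∀ z ∈ Metric.ball (0 : ℂ) 1, DifferentiableAt ℂ Q z := by
    intro z hz
    have hne : z ≠ 1 := by rintro rfl; simp at hz
    have := (differentiableAt_dslope_of_ne hne).2
      ((hd z hz).differentiableAt (Metric.isOpen_ball.mem_nhds hz))
    fun_prop
  have hcont : Continuous (fun θ : ℝ => Q (Complex.exp (θ * Complex.I))) := by
    apply hQc.comp_continuous (by fun_prop)
    intro θ
    simp [Complex.norm_exp_ofReal_mul_I]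
  have hre : Continuous (fun θ : ℝ => (Q (Complex.exp (θ * Complex.I))).re) :=
    Complex.continuous_re.comp hcont
  refine ⟨hre, ?_⟩
  change ∫ θ in (0 : ℝ)..Real.pi, (Q (Complex.exp (θ * Complex.I))).re = 0
  have havg : Real.circleAverage Q 0 1 = Q 0 :=
    circleAverage_of_differentiable_on_off_countable (s := ∅) Set.countable_empty
      (by simpa using hQc) (by simpa using hQd)
  have hfull : ∫ θ in (0 : ℝ)..(2 * Real.pi), Q (Complex.exp (θ * Complex.I)) = 0 := by
    have h0 : Q 0 = 0 := by simp [hQ]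
    rw [h0, Real.circleAverage_def] at havg
    simpa [circleMap, Real.pi_ne_zero] using havg
  have hfullre : ∫ θ in (0 : ℝ)..(2 * Real.pi), (Q (Complex.exp (θ * Complex.I))).re = 0 := by
    have := Complex.reCLM.intervalIntegral_comp_comm (hcont.intervalIntegrable
      (μ := MeasureTheory.volume) 0 (2 * Real.pi))
    simp only [Complex.reCLM_apply] at this
    rw [this, hfull, Complex.zero_re]
  -- Conjugation symmetry makes the two half circles contribute equally.
  have hrefl : ∀ θ : ℝ, (Q (Complex.exp ((2 * Real.pi - θ : ℝ) * Complex.I))).re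
      = (Q (Complex.exp (θ * Complex.I))).re := by
    intro θ
    have hexp : Complex.exp ((2 * Real.pi - θ : ℝ) * Complex.I)
        = (starRingEnd ℂ) (Complex.exp (θ * Complex.I)) := by
      rw [← Complex.exp_conj]
      simp only [map_mul, Complex.conj_ofReal, Complex.conj_I]
      push_cast
      rw [sub_mul, Complex.exp_sub, Complex.exp_two_pi_mul_I, one_div, ← Complex.exp_neg]
      ring_nf
    rw [hexp]
    have hn : ‖Complex.exp (θ * Complex.I)‖ = 1 := Complex.norm_exp_ofReal_mul_I θ
    generalize Complex.exp (θ * Complex.I) = z at hn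
    rcases eq_or_ne z 1 with rfl | hne
    · simp
    · have hne' : (starRingEnd ℂ) z ≠ 1 := by
        intro h; apply hne; simpa using congrArg (starRingEnd ℂ) h
      have hF1 : (starRingEnd ℂ) (F 1) = F 1 := by
        simpa using (hconj 1 (by simp)).symm
      have : Q ((starRingEnd ℂ) z) = (starRingEnd ℂ) (Q z) := by
        simp only [hQ, dslope_of_ne _ hne, dslope_of_ne _ hne', slope_def_field, map_mul, map_div₀,
          map_sub, map_one, hconj z hn, hF1, map_ofNat]
      rw [this, Complex.conj_re]
  have hsplit := intervalIntegral.integral_add_adjacent_intervals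
    (hre.intervalIntegrable (μ := MeasureTheory.volume) 0 Real.pi)
    (hre.intervalIntegrable (μ := MeasureTheory.volume) Real.pi (2 * Real.pi))
  have hsub := intervalIntegral.integral_comp_sub_left (a := 0) (b := Real.pi)
    (fun θ : ℝ => (Q (Complex.exp (θ * Complex.I))).re) (2 * Real.pi)
  simp only [hrefl] at hsub
  rw [show 2 * Real.pi - Real.pi = Real.pi by ring, sub_zero] at hsub
  rw [hfullre] at hsplit
  linarith

/-- The chord from `1` to `exp (i φ)` in terms of the half angle. -/
theorem exp_mul_I_sub_one_eq (φ : ℝ) :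
    Complex.exp (φ * Complex.I) - 1 =
      2 * Complex.I * Real.sin (φ / 2) * Complex.exp ((φ / 2 : ℝ) * Complex.I) := by
  have hz : Complex.exp (φ * Complex.I) =
      Complex.exp ((φ / 2 : ℝ) * Complex.I) * Complex.exp ((φ / 2 : ℝ) * Complex.I) := by
    rw [← Complex.exp_add]; push_cast; ring_nf
  have hw : Complex.exp ((φ / 2 : ℝ) * Complex.I) =
      Real.cos (φ / 2) + Real.sin (φ / 2) * Complex.I := by
    rw [Complex.exp_mul_I]; push_cast; rfl
  have hpy : (Real.cos (φ / 2) : ℂ) ^ 2 + (Real.sin (φ / 2) : ℂ) ^ 2 = 1 := by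
    exact_mod_cast Real.cos_sq_add_sin_sq (φ / 2)
  rw [hz, hw]
  linear_combination hpy - (Real.sin (φ / 2) : ℂ) ^ 2 * Complex.I_sq

/-- On the unit circle the kernel `2 * z * dslope F 1 z` recovers the conjugate kernel
`exp (i θ / 2) / sin (θ / 2)`. -/
theorem im_mul_exp_half_div_sin {F : ℂ → ℂ} (hF1 : (F 1).im = 0) {θ : ℝ}
    (hθ : θ ∈ Set.Ioo 0 Real.pi) :
    (F (Complex.exp (θ * Complex.I)) * Complex.exp ((θ / 2 : ℝ) * Complex.I)).im
        / Real.sin (θ / 2) =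
      (F 1).re + (2 * Complex.exp (θ * Complex.I) *
        dslope F 1 (Complex.exp (θ * Complex.I))).re := by
  have hs : Real.sin (θ / 2) ≠ 0 :=
    (Real.sin_pos_of_pos_of_lt_pi (by linarith [hθ.1]) (by linarith [hθ.1, hθ.2])).ne'
  have hsc : (Real.sin (θ / 2) : ℂ) ≠ 0 := by exact_mod_cast hs
  set w : ℂ := Complex.exp ((θ / 2 : ℝ) * Complex.I) with hw
  have hz : Complex.exp (θ * Complex.I) = w * w := by
    rw [hw, ← Complex.exp_add]; push_cast; ring_nf
  have hsub : w * w - 1 = 2 * Complex.I * Real.sin (θ / 2) * w := by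
    rw [← hz, exp_mul_I_sub_one_eq]
  have hw0 : w ≠ 0 := Complex.exp_ne_zero _
  have hne : w * w ≠ 1 := by
    rw [← sub_ne_zero, hsub]
    simp [hw0, hsc, -Complex.ofReal_sin]
  -- With `z = w²`, the chord formula gives `2z / (z - 1) = -i w / sin(θ/2)`.
  have hkey : 2 * (w * w) * dslope F 1 (w * w) =
      -Complex.I * ((F (w * w) - F 1) * w) / Real.sin (θ / 2) := by
    rw [dslope_of_ne _ hne, slope_def_field, hsub]
    generalize F (w * w) = y
    field_simp
    linear_combination (y - F 1) * Complex.I_sq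
  rw [hz, hkey, Complex.div_ofReal_re]
  have hre : (-Complex.I * ((F (w * w) - F 1) * w)).re =
      (F (w * w) * w).im - (F 1).re * Real.sin (θ / 2) := by
    have : w.im = Real.sin (θ / 2) := by rw [hw, Complex.exp_ofReal_mul_I_im]
    rw [← this]
    simp [hF1]; ring
  rw [hre]
  field_simp
  ring

/-! ### Powers of a single linear factor. -/

/-- The principal branch of `(1 - z * exp (i s)) ^ q`. -/
noncomputable def unitFactor (q s : ℝ) (z : ℂ) : ℂ :=
  (1 - z * Complex.exp (s * Complex.I)) ^ (q : ℂ)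

theorem one_sub_mul_exp_re_nonneg (s : ℝ) {z : ℂ} (hz : ‖z‖ ≤ 1) :
    0 ≤ (1 - z * Complex.exp (s * Complex.I)).re := by
  have := Complex.re_le_norm (z * Complex.exp (s * Complex.I))
  rw [norm_mul, Complex.norm_exp_ofReal_mul_I, mul_one] at this
  simp only [Complex.sub_re, Complex.one_re]; linarith

theorem one_sub_mul_exp_re_pos (s : ℝ) {z : ℂ} (hz : ‖z‖ < 1) :
    0 < (1 - z * Complex.exp (s * Complex.I)).re := by
  have := Complex.re_le_norm (z * Complex.exp (s * Complex.I))
  rw [norm_mul, Complex.norm_exp_ofReal_mul_I, mul_one] at this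
  simp only [Complex.sub_re, Complex.one_re]; linarith

/-- In the closed right half-plane the principal power can fail to be continuous only at `0`, and `q
> 0` settles that point. -/
theorem continuousOn_unitFactor {q : ℝ} (hq : 0 < q) (s : ℝ) :
    ContinuousOn (unitFactor q s) (Metric.closedBall 0 1) := by
  intro z hz
  have h := Complex.continuousAt_cpow_const_of_re_pos (w := (q : ℂ))
    (Or.inl (one_sub_mul_exp_re_nonneg s (by simpa using hz))) (by simpa using hq)
  refine ContinuousAt.continuousWithinAt ?_
  exact ContinuousAt.comp (f := fun z => 1 - z * Complex.exp (s * Complex.I)) h (by fun_prop)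

theorem differentiableAt_unitFactor (q s : ℝ) {z : ℂ}
    (hz : 0 < (1 - z * Complex.exp (s * Complex.I)).re) :
    DifferentiableAt ℂ (unitFactor q s) z := by
  unfold unitFactor
  exact DifferentiableAt.cpow (by fun_prop) (by fun_prop) (Or.inl hz)

theorem differentiableAt_unitFactor_one (q : ℝ) {s : ℝ} (hs : Real.cos s < 1) :
    DifferentiableAt ℂ (unitFactor q s) 1 :=
  differentiableAt_unitFactor q s (by simpa [Complex.exp_ofReal_mul_I_re] using hs)

theorem unitFactor_conj (q s : ℝ) {z : ℂ} (hz : ‖z‖ ≤ 1) :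
    unitFactor q s ((starRingEnd ℂ) z) = (starRingEnd ℂ) (unitFactor q (-s) z) := by
  have harg : (1 - z * Complex.exp ((-s : ℝ) * Complex.I)).arg ≠ Real.pi := by
    intro h
    have := (Complex.arg_eq_pi_iff.1 h).1
    linarith [one_sub_mul_exp_re_nonneg (-s) hz]
  have hq : (q : ℂ) = (starRingEnd ℂ) (q : ℂ) := (Complex.conj_ofReal q).symm
  unfold unitFactor
  nth_rewrite 2 [hq]
  rw [← Complex.conj_cpow _ _ harg]
  simp [← Complex.exp_conj]

/-- The principal power of a complex number given in polar form. -/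
theorem ofReal_mul_exp_cpow {ρ α : ℝ} (hρ : 0 < ρ) (hα : α ∈ Set.Ioc (-Real.pi) Real.pi) (q : ℝ)
    {x : ℂ} (hx : x = ρ * Complex.exp (α * Complex.I)) :
    x ^ (q : ℂ) = ((‖x‖ ^ q : ℝ) : ℂ) * Complex.exp ((q * α : ℝ) * Complex.I) := by
  have hn : ‖x‖ = ρ := by
    rw [hx, norm_mul, Complex.norm_exp_ofReal_mul_I, mul_one, Complex.norm_real,
      Real.norm_of_nonneg hρ.le]
  have hx0 : x ≠ 0 := by rw [← norm_pos_iff, hn]; exact hρ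
  have hlog : Complex.log x = Real.log ρ + α * Complex.I := by
    rw [Complex.log, hn, hx, Complex.exp_mul_I, Complex.arg_mul_cos_add_sin_mul_I hρ hα]
  rw [Complex.cpow_def_of_ne_zero hx0, hlog, hn, Real.rpow_def_of_pos hρ, Complex.ofReal_exp,
    ← Complex.exp_add]
  push_cast
  ring_nf

/-- With `φ = θ + s`, `1 - e^{iφ} = 2 sin(φ/2) e^{i(φ-π)/2}`, a polar form with principal angle as
the sine is positive. -/
theorem unitFactor_exp_of_pos (q : ℝ) {s θ : ℝ} (h0 : 0 < θ + s) (h2 : θ + s < 2 * Real.pi) :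
    unitFactor q s (Complex.exp (θ * Complex.I)) =
      ((‖1 - Complex.exp (θ * Complex.I) * Complex.exp (s * Complex.I)‖ ^ q : ℝ) : ℂ) *
        Complex.exp ((q * ((θ + s - Real.pi) / 2) : ℝ) * Complex.I) := by
  have hsin : 0 < Real.sin ((θ + s) / 2) :=
    Real.sin_pos_of_pos_of_lt_pi (by linarith) (by linarith)
  refine ofReal_mul_exp_cpow (ρ := 2 * Real.sin ((θ + s) / 2)) (by positivity)
    ⟨by linarith [Real.pi_pos], by linarith⟩ q ?_
  have hexp : Complex.exp (((θ + s - Real.pi) / 2 : ℝ) * Complex.I) =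
      -Complex.I * Complex.exp (((θ + s) / 2 : ℝ) * Complex.I) := by
    rw [← Complex.exp_neg_pi_div_two_mul_I, ← Complex.exp_add]
    push_cast
    ring_nf
  rw [hexp, ← Complex.exp_add, ← add_mul, ← Complex.ofReal_add, Complex.ofReal_mul]
  push_cast [-Complex.ofReal_sin, -Complex.ofReal_add, -Complex.ofReal_div]
  linear_combination -exp_mul_I_sub_one_eq (θ + s)

/-- Here the sine is negative, so its sign moves the angle by `π`; this is the source of the phase
jump `πq` at a zero. -/
theorem unitFactor_exp_of_neg (q : ℝ) {s θ : ℝ} (h0 : θ + s < 0) (h2 : -(2 * Real.pi) < θ + s) :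
    unitFactor q s (Complex.exp (θ * Complex.I)) =
      ((‖1 - Complex.exp (θ * Complex.I) * Complex.exp (s * Complex.I)‖ ^ q : ℝ) : ℂ) *
        Complex.exp ((q * ((θ + s + Real.pi) / 2) : ℝ) * Complex.I) := by
  have hsin : 0 < -Real.sin ((θ + s) / 2) := by
    rw [← Real.sin_neg]
    exact Real.sin_pos_of_pos_of_lt_pi (by linarith) (by linarith)
  refine ofReal_mul_exp_cpow (ρ := 2 * -Real.sin ((θ + s) / 2)) (by positivity)
    ⟨by linarith, by linarith [Real.pi_pos]⟩ q ?_
  have hexp : Complex.exp (((θ + s + Real.pi) / 2 : ℝ) * Complex.I) =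
      Complex.I * Complex.exp (((θ + s) / 2 : ℝ) * Complex.I) := by
    nth_rewrite 2 [← Complex.exp_pi_div_two_mul_I]
    rw [← Complex.exp_add]
    push_cast
    ring_nf
  rw [hexp, ← Complex.exp_add, ← add_mul, ← Complex.ofReal_add, Complex.ofReal_mul]
  push_cast [-Complex.ofReal_sin, -Complex.ofReal_add, -Complex.ofReal_div]
  linear_combination -exp_mul_I_sub_one_eq (θ + s)

theorem norm_one_sub_exp_mul_exp (θ s : ℝ) :
    ‖1 - Complex.exp (θ * Complex.I) * Complex.exp (s * Complex.I)‖ =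
      ‖Complex.exp (θ * Complex.I) - Complex.exp (-s * Complex.I)‖ := by
  have h : 1 - Complex.exp (θ * Complex.I) * Complex.exp (s * Complex.I) =
      -(Complex.exp (s * Complex.I)) *
        (Complex.exp (θ * Complex.I) - Complex.exp (-s * Complex.I)) := by
    have : Complex.exp (s * Complex.I) * Complex.exp (-s * Complex.I) = 1 := by
      rw [← Complex.exp_add]; simp
    linear_combination -this
  rw [h, norm_mul, norm_neg, Complex.norm_exp_ofReal_mul_I, one_mul]

/-- Boundary values of the factor attached to a conjugate pair of zeros, on `[0, π)`. -/
theorem unitFactor_pair_exp (q : ℝ) {s θ : ℝ} (hs : 0 < s) (hsπ : s ≤ Real.pi) (hθ : 0 ≤ θ)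
    (hθπ : θ < Real.pi) (p : Prop) [Decidable p] (hp : p → s < θ) (hnp : ¬ p → θ < s) :
    unitFactor q (-s) (Complex.exp (θ * Complex.I)) *
        unitFactor q s (Complex.exp (θ * Complex.I)) =
      ((‖(Complex.exp (θ * Complex.I) - Complex.exp (s * Complex.I)) *
        (Complex.exp (θ * Complex.I) - Complex.exp (-s * Complex.I))‖ ^ q : ℝ) : ℂ) *
        Complex.exp ((q * (θ - if p then Real.pi else 0) : ℝ) * Complex.I) := by
  have hneg : ‖1 - Complex.exp (θ * Complex.I) * Complex.exp ((-s : ℝ) * Complex.I)‖ =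
      ‖Complex.exp (θ * Complex.I) - Complex.exp (s * Complex.I)‖ := by
    simpa using norm_one_sub_exp_mul_exp θ (-s)
  -- `θ < π` is strict, so `θ + s < 2π` even when `s = π`.
  rw [unitFactor_exp_of_pos q (s := s) (by linarith) (by linarith), norm_one_sub_exp_mul_exp,
    norm_mul, Real.mul_rpow (norm_nonneg _) (norm_nonneg _)]
  by_cases h : p
  · have := hp h
    rw [unitFactor_exp_of_pos q (by linarith) (by linarith), hneg, if_pos h, mul_mul_mul_comm,
      ← Complex.exp_add, Complex.ofReal_mul]
    push_cast
    ring_nf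
  · have := hnp h
    rw [unitFactor_exp_of_neg q (by linarith) (by linarith), hneg, if_neg h, mul_mul_mul_comm,
      ← Complex.exp_add, Complex.ofReal_mul]
    push_cast
    ring_nf

/-! ### The holomorphic `q`-th power on the disc and its boundary phase. -/

/-- The branch of `|c| ^ q * (1 + z) ^ (ε q) * ∏ j, ((1 - z e^{-i t j}) (1 - z e^{i t j})) ^ q`
on the closed unit disc, with `ε` the parity of `d`. -/
noncomputable def diskPower (q A : ℝ) (d : ℕ) (t : ℕ → ℝ) (z : ℂ) : ℂ :=
  ((A ^ q : ℝ) : ℂ) *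
    (∏ j ∈ Finset.Icc 1 (d / 2), unitFactor q (-t j) z * unitFactor q (t j) z) *
    (if Odd d then unitFactor q Real.pi z else 1)

theorem continuousOn_diskPower {q : ℝ} (hq : 0 < q) (A : ℝ) (d : ℕ) (t : ℕ → ℝ) :
    ContinuousOn (diskPower q A d t) (Metric.closedBall 0 1) := by
  unfold diskPower
  refine (continuousOn_const.mul (continuousOn_finsetProd _ fun j _ =>
    (continuousOn_unitFactor hq _).mul (continuousOn_unitFactor hq _))).mul ?_
  split_ifs
  · exact continuousOn_unitFactor hq _
  · exact continuousOn_const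

theorem differentiableAt_diskPower {q A : ℝ} {d : ℕ} {t : ℕ → ℝ} {z : ℂ}
    (h : ∀ j ∈ Finset.Icc 1 (d / 2), DifferentiableAt ℂ (unitFactor q (-t j)) z ∧
      DifferentiableAt ℂ (unitFactor q (t j)) z)
    (hπ : DifferentiableAt ℂ (unitFactor q Real.pi) z) :
    DifferentiableAt ℂ (diskPower q A d t) z := by
  unfold diskPower
  refine ((differentiableAt_const _).mul (DifferentiableAt.fun_finsetProd fun j hj =>
    (h j hj).1.mul (h j hj).2)).mul ?_
  split_ifs
  · exact hπ
  · exact differentiableAt_const _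

theorem differentiableOn_diskPower (q A : ℝ) (d : ℕ) (t : ℕ → ℝ) :
    DifferentiableOn ℂ (diskPower q A d t) (Metric.ball 0 1) := fun z hz => by
  have hz' : ‖z‖ < 1 := by simpa using hz
  exact (differentiableAt_diskPower
    (fun j _ => ⟨differentiableAt_unitFactor _ _ (one_sub_mul_exp_re_pos _ hz'),
      differentiableAt_unitFactor _ _ (one_sub_mul_exp_re_pos _ hz')⟩)
    (differentiableAt_unitFactor _ _ (one_sub_mul_exp_re_pos _ hz'))).differentiableWithinAt

theorem differentiableAt_diskPower_one (q A : ℝ) {d : ℕ} {t : ℕ → ℝ}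
    (ht : ∀ j ∈ Finset.Icc 1 (d / 2), 0 < t j ∧ t j ≤ Real.pi) :
    DifferentiableAt ℂ (diskPower q A d t) 1 := by
  have hcos : ∀ s : ℝ, 0 < s → s ≤ Real.pi → Real.cos s < 1 := fun s h0 hπ => by
    simpa using Real.cos_lt_cos_of_nonneg_of_le_pi le_rfl hπ h0
  refine differentiableAt_diskPower (fun j hj => ?_)
    (differentiableAt_unitFactor_one _ (hcos _ Real.pi_pos le_rfl))
  have := hcos _ (ht j hj).1 (ht j hj).2
  exact ⟨differentiableAt_unitFactor_one _ (by rwa [Real.cos_neg]),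
    differentiableAt_unitFactor_one _ this⟩

theorem diskPower_conj (q A : ℝ) (d : ℕ) (t : ℕ → ℝ) {z : ℂ} (hz : ‖z‖ ≤ 1) :
    diskPower q A d t ((starRingEnd ℂ) z) = (starRingEnd ℂ) (diskPower q A d t z) := by
  -- Conjugation swaps the two factors of a pair and fixes the factor of the zero `-1`.
  have hπ : unitFactor q (-Real.pi) z = unitFactor q Real.pi z := by
    simp [unitFactor, Complex.exp_neg]
  unfold diskPower
  simp only [map_mul, map_prod, Complex.conj_ofReal, unitFactor_conj q _ hz, neg_neg, hπ]
  congr 1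
  · congr 1
    exact Finset.prod_congr rfl fun j _ => mul_comm _ _
  · split_ifs <;> simp

/-- Boundary values of `diskPower` on the arc between the `n`-th and the `(n + 1)`-st zero. -/
theorem diskPower_exp (q A : ℝ) (hA : 0 ≤ A) {d : ℕ} {t : ℕ → ℝ}
    (ht : ∀ j ∈ Finset.Icc 1 (d / 2), 0 < t j ∧ t j ≤ Real.pi) {n : ℕ} (hn : n ≤ d / 2) {θ : ℝ}
    (hθ : 0 ≤ θ) (hθπ : θ < Real.pi)
    (hlow : ∀ j ∈ Finset.Icc 1 (d / 2), j ≤ n → t j < θ)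
    (hhigh : ∀ j ∈ Finset.Icc 1 (d / 2), n < j → θ < t j) :
    diskPower q A d t (Complex.exp (θ * Complex.I)) =
      (((A * (∏ j ∈ Finset.Icc 1 (d / 2),
        ‖(Complex.exp (θ * Complex.I) - Complex.exp (t j * Complex.I)) *
          (Complex.exp (θ * Complex.I) - Complex.exp (-t j * Complex.I))‖) *
        (if Odd d then ‖Complex.exp (θ * Complex.I) + 1‖ else 1)) ^ q : ℝ) : ℂ) *
      Complex.exp (((d : ℝ) / 2 * q * θ - Real.pi * q * n : ℝ) * Complex.I) := by
  have hprod : ∏ j ∈ Finset.Icc 1 (d / 2), unitFactor q (-t j) (Complex.exp (θ * Complex.I)) *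
        unitFactor q (t j) (Complex.exp (θ * Complex.I)) =
      (((∏ j ∈ Finset.Icc 1 (d / 2),
        ‖(Complex.exp (θ * Complex.I) - Complex.exp (t j * Complex.I)) *
          (Complex.exp (θ * Complex.I) - Complex.exp (-t j * Complex.I))‖) ^ q : ℝ) : ℂ) *
        Complex.exp ((q * ((d / 2 : ℕ) * θ - n * Real.pi) : ℝ) * Complex.I) := by
    rw [Finset.prod_congr rfl fun j hj => unitFactor_pair_exp q (ht j hj).1 (ht j hj).2 hθ hθπ
      (j ≤ n) (hlow j hj) (fun h => hhigh j hj (not_le.1 h)), Finset.prod_mul_distrib,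
      ← Complex.exp_sum, ← Complex.ofReal_prod, ← Finset.sum_mul, ← Complex.ofReal_sum,
      ← Finset.mul_sum, Real.finsetProd_rpow _ _ fun j _ => norm_nonneg _,
      Finset.sum_sub_distrib, Finset.sum_const, ← Finset.sum_filter, Finset.sum_const]
    -- Exactly `n` pairs have been passed, each contributing `-πq`.
    have hfilter : (Finset.Icc 1 (d / 2)).filter (fun j => j ≤ n) = Finset.Icc 1 n := by
      ext j; simp only [Finset.mem_filter, Finset.mem_Icc]; omega
    rw [hfilter]
    simp
  -- `d/2 - ⌊d/2⌋` is `1/2` for odd `d` and `0` for even `d`, so the unpaired zero supplies the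
  -- missing `qθ/2`.
  have hodd : (if Odd d then unitFactor q Real.pi (Complex.exp (θ * Complex.I)) else 1) =
      (((if Odd d then ‖Complex.exp (θ * Complex.I) + 1‖ else 1) ^ q : ℝ) : ℂ) *
        Complex.exp ((q * ((d : ℝ) / 2 - (d / 2 : ℕ)) * θ : ℝ) * Complex.I) := by
    split_ifs with h
    · obtain ⟨m, rfl⟩ := h
      rw [unitFactor_exp_of_pos q (by linarith) (by linarith),
        show (2 * m + 1) / 2 = m by omega]
      congr 2
      · simp [Complex.exp_pi_mul_I, add_comm]
      · push_cast; ring_nf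
    · obtain ⟨m, rfl⟩ := Nat.not_odd_iff_even.1 h
      rw [show (m + m) / 2 = m by omega]
      simp
  rw [diskPower, hprod, hodd, Real.mul_rpow, Real.mul_rpow hA,
    Complex.ofReal_mul (A ^ q * _ ^ q), Complex.ofReal_mul (A ^ q)]
  · have hexp : Complex.exp (((d : ℝ) / 2 * q * θ - Real.pi * q * n : ℝ) * Complex.I) =
        Complex.exp ((q * ((d / 2 : ℕ) * θ - n * Real.pi) : ℝ) * Complex.I) *
        Complex.exp ((q * ((d : ℝ) / 2 - (d / 2 : ℕ)) * θ : ℝ) * Complex.I) := by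
      rw [← Complex.exp_add, ← add_mul, ← Complex.ofReal_add]
      ring_nf
    rw [hexp]
    ring
  · exact Finset.prod_nonneg fun j _ => norm_nonneg _
  · exact mul_nonneg hA (Finset.prod_nonneg fun j _ => norm_nonneg _)
  · split_ifs <;> positivity

/-! ### Factorization of `P` and summation over the arcs. -/

/-- The modulus of a polynomial whose zeros come in conjugate pairs on the unit circle. -/
theorem norm_eval_of_roots_eq {d : ℕ} {P : Polynomial ℂ} {t : ℕ → ℝ}
    (hroots : P.roots =
      (∑ j ∈ Finset.Icc 1 (d / 2),
        ({Complex.exp (t j * Complex.I), Complex.exp (-t j * Complex.I)} : Multiset ℂ)) +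
      (if Odd d then {-1} else 0)) (z : ℂ) :
    ‖P.eval z‖ = ‖P.leadingCoeff‖ * (∏ j ∈ Finset.Icc 1 (d / 2),
        ‖(z - Complex.exp (t j * Complex.I)) * (z - Complex.exp (-t j * Complex.I))‖) *
        (if Odd d then ‖z + 1‖ else 1) := by
  have hsplit : P = Polynomial.C P.leadingCoeff *
      (P.roots.map fun a => Polynomial.X - Polynomial.C a).prod :=
    (IsAlgClosed.splits P).eq_prod_roots
  have heval : P.eval z = P.leadingCoeff * (P.roots.map fun a => z - a).prod := by
    conv_lhs => rw [hsplit]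
    simp [Polynomial.eval_multiset_prod, Multiset.map_map]
  have hsum : ((∑ j ∈ Finset.Icc 1 (d / 2), ({Complex.exp (t j * Complex.I),
      Complex.exp (-t j * Complex.I)} : Multiset ℂ)).map fun a => z - a).prod =
      ∏ j ∈ Finset.Icc 1 (d / 2),
        ((z - Complex.exp (t j * Complex.I)) * (z - Complex.exp (-t j * Complex.I))) := by
    induction Finset.Icc 1 (d / 2) using Finset.induction_on with
    | empty => simp
    | insert a s ha ih =>
      rw [Finset.sum_insert ha, Finset.prod_insert ha, Multiset.map_add, Multiset.prod_add, ih]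
      simp
  rw [heval, hroots, Multiset.map_add, Multiset.prod_add, hsum, norm_mul, norm_mul, norm_prod,
    mul_assoc]
  congr 2
  split_ifs <;> simp

theorem theorem3p2 (d : ℕ) (P : Polynomial ℂ) (hdeg : P.degree = (d : WithBot ℕ))
    (hsymm : ∀ θ : ℝ, P.eval (Complex.exp (θ * Complex.I)) =
      (starRingEnd ℂ) (P.eval (Complex.exp (-θ * Complex.I))))
    (t : ℕ → ℝ) (ht_zero : t 0 = 0) (ht_last : t (d / 2 + 1) = Real.pi)
    (ht_mem : ∀ j ∈ Finset.Icc 1 (d / 2), 0 < t j ∧ t j ≤ Real.pi)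
    (ht_mono : MonotoneOn t (Set.Icc 1 (d / 2)))
    -- the zeros of `P`, listed with multiplicity
    (hroots : P.roots =
      (∑ j ∈ Finset.Icc 1 (d / 2),
        ({Complex.exp (t j * Complex.I), Complex.exp (-t j * Complex.I)} : Multiset ℂ)) +
      (if Odd d then {-1} else 0))
    (q : ℝ) (hq : 0 < q) :
    (∀ n ∈ Finset.range (d / 2 + 1),
      IntervalIntegrable (fun θ : ℝ => ‖P.eval (Complex.exp (θ * Complex.I))‖ ^ q *
        (Real.sin (((d : ℝ) / 2 * q + 1 / 2) * θ - Real.pi * q * n) / Real.sin (θ / 2)))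
        MeasureTheory.volume (t n) (t (n + 1))) ∧
    ‖P.eval 1‖ ^ q =
      ∑ n ∈ Finset.range (d / 2 + 1), (1 / Real.pi) *
        ∫ θ in (t n)..(t (n + 1)), ‖P.eval (Complex.exp (θ * Complex.I))‖ ^ q *
          (Real.sin (((d : ℝ) / 2 * q + 1 / 2) * θ - Real.pi * q * n) / Real.sin (θ / 2)) := by
  have hmono : ∀ i j, i ≤ j → j ≤ d / 2 + 1 → t i ≤ t j := by
    intro i j hij hj
    rcases Nat.eq_zero_or_pos i with rfl | hi
    · rcases Nat.eq_zero_or_pos j with rfl | hj0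
      · exact le_rfl
      rcases hj.lt_or_eq with h | rfl
      · rw [ht_zero]; exact (ht_mem j (Finset.mem_Icc.2 ⟨hj0, by omega⟩)).1.le
      · rw [ht_zero, ht_last]; exact Real.pi_pos.le
    · rcases hj.lt_or_eq with h | rfl
      · exact ht_mono ⟨hi, by omega⟩ ⟨by omega, by omega⟩ hij
      · rcases hij.lt_or_eq with h | rfl
        · rw [ht_last]; exact (ht_mem i (Finset.mem_Icc.2 ⟨hi, by omega⟩)).2
        · exact le_rfl
  set F := diskPower q ‖P.leadingCoeff‖ d t with hF
  have hbdry : ∀ n ≤ d / 2, ∀ θ : ℝ, 0 ≤ θ → θ < Real.pi →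
      (∀ j ∈ Finset.Icc 1 (d / 2), j ≤ n → t j < θ) →
      (∀ j ∈ Finset.Icc 1 (d / 2), n < j → θ < t j) →
      F (Complex.exp (θ * Complex.I)) = ((‖P.eval (Complex.exp (θ * Complex.I))‖ ^ q : ℝ) : ℂ) *
        Complex.exp (((d : ℝ) / 2 * q * θ - Real.pi * q * n : ℝ) * Complex.I) := by
    intro n hn θ h0 hπ hlow hhigh
    rw [norm_eval_of_roots_eq hroots]
    exact diskPower_exp q _ (norm_nonneg _) ht_mem hn h0 hπ hlow hhigh
  -- At `θ = 0` no zero has been passed (`n = 0`), so the phase is trivial.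
  have hF1 : F 1 = ((‖P.eval 1‖ ^ q : ℝ) : ℂ) := by
    have := hbdry 0 (Nat.zero_le _) 0 le_rfl Real.pi_pos
      (fun j hj h => by rw [Finset.mem_Icc] at hj; omega) (fun j hj _ => (ht_mem j hj).1)
    simpa using this
  obtain ⟨hcont, hint⟩ := integral_re_two_mul_dslope_eq_zero
    (continuousOn_diskPower hq ‖P.leadingCoeff‖ d t)
    (differentiableOn_diskPower q ‖P.leadingCoeff‖ d t)
    (differentiableAt_diskPower_one q ‖P.leadingCoeff‖ ht_mem)
    (fun z hz => diskPower_conj q ‖P.leadingCoeff‖ d t hz.le)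
  rw [← hF] at hcont hint
  set K : ℝ → ℝ := fun θ => (F 1).re + (2 * Complex.exp (θ * Complex.I) *
    dslope F 1 (Complex.exp (θ * Complex.I))).re with hK
  have hKcont : Continuous K := continuous_const.add hcont
  have hKint : ∫ θ in (0 : ℝ)..Real.pi, K θ = Real.pi * ‖P.eval 1‖ ^ q := by
    rw [hK, intervalIntegral.integral_add intervalIntegrable_const
      (hcont.intervalIntegrable _ _), hint, hF1]
    simp
  -- Open arcs suffice for the integrals; they avoid the zeros and `θ = 0`, and are empty at
  -- repeated `t j`.
  have hEq : ∀ n ≤ d / 2, Set.EqOn K (fun θ : ℝ => ‖P.eval (Complex.exp (θ * Complex.I))‖ ^ q *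
      (Real.sin (((d : ℝ) / 2 * q + 1 / 2) * θ - Real.pi * q * n) / Real.sin (θ / 2)))
      (Set.Ioo (t n) (t (n + 1))) := by
    intro n hn θ hθ
    have h0 : 0 < θ := lt_of_le_of_lt (ht_zero ▸ hmono 0 n (Nat.zero_le _) (by omega)) hθ.1
    have hπ : θ < Real.pi := lt_of_lt_of_le hθ.2 (ht_last ▸ hmono _ _ (by omega) le_rfl)
    have hb := hbdry n hn θ h0.le hπ
      (fun j hj h => lt_of_le_of_lt (hmono j n h (by omega)) hθ.1)
      (fun j hj h => lt_of_lt_of_le hθ.2 (hmono (n + 1) j h (by rw [Finset.mem_Icc] at hj; omega)))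
    change K θ = _
    rw [hK]
    simp only
    rw [← im_mul_exp_half_div_sin (by rw [hF1, Complex.ofReal_im]) ⟨h0, hπ⟩, hb, mul_assoc,
      ← Complex.exp_add, ← add_mul, ← Complex.ofReal_add, Complex.im_ofReal_mul,
      Complex.exp_ofReal_mul_I_im, mul_div_assoc]
    ring_nf
  refine ⟨fun n hn => ?_, ?_⟩
  · have hn' : n ≤ d / 2 := by rw [Finset.mem_range] at hn; omega
    refine (hKcont.intervalIntegrable _ _).congr_uIoo ?_
    rw [Set.uIoo_of_le (hmono n (n + 1) (by omega) (by omega))]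
    exact hEq n hn'
  · have hcongr : ∀ n ∈ Finset.range (d / 2 + 1),
        (1 / Real.pi) * ∫ θ in (t n)..(t (n + 1)), ‖P.eval (Complex.exp (θ * Complex.I))‖ ^ q *
          (Real.sin (((d : ℝ) / 2 * q + 1 / 2) * θ - Real.pi * q * n) / Real.sin (θ / 2)) =
        (1 / Real.pi) * ∫ θ in (t n)..(t (n + 1)), K θ := by
      intro n hn
      have hn' : n ≤ d / 2 := by rw [Finset.mem_range] at hn; omega
      rw [intervalIntegral.integral_congr_Ioo_of_le (hmono n (n + 1) (by omega) (by omega))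
        (hEq n hn')]
    rw [Finset.sum_congr rfl hcongr, ← Finset.mul_sum,
      intervalIntegral.sum_integral_adjacent_intervals
        (fun n _ => hKcont.intervalIntegrable _ _), ht_zero, ht_last, hKint]
    field_simp
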